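/- Let $p$ be a prime and let $k$ be an algebraically closed field of characteristic $p$. Let $W_2$ be the ring of Witt vectors $(a_0,a_1)$ of length two over $k$, regarded as a ring variety with underlying variety $\mathbf{A}^2_{/k}$, so that $\Gamma_2=\mathrm{SL}_2(W_2)$ is an affine algebraic group over $k$. For $w\in W_2$ and $t\in k^\times$ put $$\mathscr{X}_2(w)=\begin{pmatrix}1&w\\0&1\end{pmatrix},\qquad \phi(t)=\begin{pmatrix}(t,0)&0\\0&(t^{-1},0)\end{pmatrix},$$ let $T=\phi(k^\times)$, and let $H=\mathscr{X}_2(W_2)\rtimes T$ be the closed subgroup of $\Gamma_2$ generated by $\mathscr{X}_2(W_2)$ and $T$. Let $(\rho,V)$ be a rational representation of $H$ on a $k$-vector space $V$ (of finite or infinite dimension; i.e. a comodule for the coordinate ring $k[H]$), and for $\mu\in\mathbf{Z}$ let $$V_\mu=\{v\in V : \rho(\phi(t))v=t^\mu v\ \text{for all}\ t\in k^\times\}.$$ Suppose that $\rho(\mathscr{X}_2(0,1))\neq 1_V$. Then there are integers $s>0$ and $\lambda$ such that $V_{\lambda+2sj}\neq 0$ for all integers $0\le j\le p$. In particular, $T$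 has at least $p+1$ distinct weights on $V$, i.e. there are at least $p+1$ integers $\mu$ with $V_\mu\neq 0$. -/

import Mathlib

noncomputable section

namespace WittSL2

variable (p : ℕ) [Fact p.Prime] (k : Type*) [Field k]

/-- The ring of Witt vectors of length two over `k`. -/
abbrev W2 : Type _ := TruncatedWittVector p 2 k

/-- The group `SL₂(W₂)`. -/
abbrev Gamma2 : Type _ := Matrix.SpecialLinearGroup (Fin 2) (W2 p k)

variable {k} in
/-- The Witt vector `(a₀, a₁)`. -/
def witt (a₀ a₁ : k) : W2 p k := TruncatedWittVector.mk p ![a₀, a₁]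

/-- The multiplicative map `t ↦ (t, 0)` from `k` to `W₂`. -/
def teich : k →* W2 p k :=
  (WittVector.truncate 2 : WittVector p k →+* W2 p k).toMonoidHom.comp (WittVector.teichmuller p)

theorem teich_eq (t : k) : teich p k t = witt p t 0 := by
  ext i
  fin_cases i
  · simp [teich, witt, WittVector.coeff_truncate, WittVector.teichmuller_coeff_zero]
  · simp [teich, witt, WittVector.coeff_truncate, WittVector.teichmuller_coeff_pos]

/-- The matrix `[[1, w], [0, 1]]`. -/
def upper (w : W2 p k) : Gamma2 p k := ⟨!![1, w; 0, 1], by simp [Matrix.det_fin_two]⟩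

theorem coe_upper (w : W2 p k) :
    (upper p k w : Matrix (Fin 2) (Fin 2) (W2 p k)) = !![1, w; 0, 1] := rfl

/-- The homomorphism `w ↦ [[1, w], [0, 1]]` from the additive group of `W₂`. -/
def X2 : Multiplicative (W2 p k) →* Gamma2 p k where
  toFun w := upper p k w.toAdd
  map_one' := Subtype.ext (by
    rw [coe_upper, Matrix.SpecialLinearGroup.coe_one, Matrix.one_fin_two, toAdd_one])
  map_mul' v w := Subtype.ext (by
    rw [Matrix.SpecialLinearGroup.coe_mul, coe_upper, coe_upper, coe_upper]
    simp [add_comm])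

/-- The matrix `diag((t, 0), (t⁻¹, 0))`. -/
def diag (t : kˣ) : Gamma2 p k :=
  ⟨!![teich p k (t : k), 0; 0, teich p k ((t⁻¹ : kˣ) : k)], by
    rw [Matrix.det_fin_two_of, ← map_mul]
    simp⟩

theorem coe_diag (t : kˣ) : (diag p k t : Matrix (Fin 2) (Fin 2) (W2 p k)) =
    !![teich p k (t : k), 0; 0, teich p k ((t⁻¹ : kˣ) : k)] := rfl

/-- The cocharacter `t ↦ diag((t, 0), (t⁻¹, 0))`; its image is the torus `T`. -/
def phi : kˣ →* Gamma2 p k where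
  toFun t := diag p k t
  map_one' := Subtype.ext (by
    rw [coe_diag, Matrix.SpecialLinearGroup.coe_one, Matrix.one_fin_two]
    simp)
  map_mul' s t := Subtype.ext (by
    rw [Matrix.SpecialLinearGroup.coe_mul, coe_diag, coe_diag, coe_diag]
    simp [mul_comm])

/-- The subgroup `H` of `SL₂(W₂)` generated by the image of `X2` and the torus `T`. -/
def H : Subgroup (Gamma2 p k) := (X2 p k).range ⊔ (phi p k).range

/-- `X2` as a map into `H`. -/
def X2H (w : W2 p k) : H p k :=
  ⟨X2 p k (Multiplicative.ofAdd w), Subgroup.mem_sup_left ⟨_, rfl⟩⟩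

/-- `phi` as a map into `H`. -/
def phiH (t : kˣ) : H p k :=
  ⟨phi p k t, Subgroup.mem_sup_right ⟨t, rfl⟩⟩

/-- The algebra `k[H]` of regular functions on the closed subvariety `H` of the eight-dimensional
affine space of `2 × 2` matrices over `W₂`: the restrictions to `H` of the polynomials in the Witt
coordinates of the matrix entries. -/
def regularFunctions : Subalgebra k (H p k → k) :=
  (MvPolynomial.aeval fun (c : Fin 2 × Fin 2 × Fin 2) (h : H p k) =>
    TruncatedWittVector.coeff c.2.2 ((h : Gamma2 p k) c.1 c.2.1)).range

variable {p k} {V : Type*} [AddCommGroup V] [Module k V]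

/-- A representation of `H` on a vector space (of any dimension) is rational if it comes from a
comodule map `V → V ⊗ k[H]`: for every `v` there are finitely many vectors `wᵢ` and regular
functions `fᵢ` on `H` with `ρ(h) v = ∑ fᵢ(h) wᵢ` for all `h`. -/
def IsRational (ρ : Representation k (H p k) V) : Prop :=
  ∀ v : V, ∃ (n : ℕ) (w : Fin n → V) (f : Fin n → regularFunctions p k),
    ∀ h : H p k, ρ h v = ∑ i, (f i : H p k → k) h • w i

/-- The weight space `V_μ` of the torus `T`, the integer `μ` standing for the character
`phi t ↦ t ^ μ` of `T`. -/
def weightSpace (ρ : Representation k (H p k) V) (μ : ℤ) : Submodule k V where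
  carrier := {v | ∀ t : kˣ, ρ (phiH p k t) v = ((t ^ μ : kˣ) : k) • v}
  add_mem' hv hw t := by rw [map_add, hv t, hw t, smul_add]
  zero_mem' t := by simp
  smul_mem' c v hv t := by rw [map_smul, hv t, smul_comm]

end WittSL2

end

/-! Write the actions of $(a,0)$ and $(0,b)$ as $R_a v=\sum a^iA_iv$ and $S_b v=\sum b^iB_iv$.
Conjugation by $\phi(t)$ sends $(a,b)$ to $(t^2a,t^{2p}b)$, so $A_i$ raises weights by $2i$ and
$B_i$ by $2pi$ (`coeff_mem_weightSpace`). As $(0,1)$ acts nontrivially, some $B_n$ with $n>0$ is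
nonzero on a weight vector; take $n$ minimal, with such a $v$ of weight $\mu$. Additivity of $S$
forces $n=p^m$ (`eq_pow_of_forall_coeff_eq_zero`). Let $c$ be the Witt carry, so that
$R_aR_b=R_{a+b}S_{c(a,b)}$. For $i+j=p$ with $i,j>0$, the coefficient of $a^{p^mi}b^{p^mj}$ on the
right, applied to $v$, is a nonzero multiple of $B_{p^m}v$, because $c$ contains $a^ib^j$ modulo
$p$. Hence $A_{p^mj}v\ne0$ (`coeff_ne_zero_of_carry`). With $s=p^m$, the vectors $v$, $A_{sj}v$ for
$0<j<p$, and $B_sv$ have weights $\mu+2sj$ for $0\le j\le p$. -/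

namespace WittSL2

open MvPolynomial

/-! ### The carry polynomial modulo $p$ -/

section Carry

variable (p : ℕ) [Fact p.Prime]

/-- The carry polynomial `(X₀ ^ p + X₁ ^ p - (X₀ + X₁) ^ p) / p` of the addition of Witt vectors. -/
noncomputable def carry : MvPolynomial (Fin 2) ℤ :=
  aeval (fun c : Fin 2 × ℕ => if c.2 = 0 then X c.1 else 0) (WittVector.wittAdd p 1)

theorem natCast_mul_carry :
    (p : MvPolynomial (Fin 2) ℤ) * carry p = X 0 ^ p + X 1 ^ p - (X 0 + X 1) ^ p := by
  -- The ghost component identity in degree one, specialised to Witt vectors with all higher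
  -- coordinates zero.
  have h := wittStructureInt_prop p (X 0 + X 1 : MvPolynomial (Fin 2) ℤ) 1
  have h' := congrArg
    (aeval (fun c : Fin 2 × ℕ => if c.2 = 0 then (X c.1 : MvPolynomial (Fin 2) ℤ) else 0)) h
  change aeval _ (bind₁ (WittVector.wittAdd p) _) = _ at h'
  simp only [wittPolynomial_one, map_add, map_mul, map_pow, bind₁_X_right, rename_X,
    WittVector.wittAdd_zero, aeval_X, if_true, one_ne_zero, if_false, mul_zero, zero_add,
    algHom_C] at h'
  change _ * carry p + _ = _ at h'
  rw [← h']
  simp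

theorem carry_isHomogeneous : (carry p).IsHomogeneous p := by
  have hp : ((p : ℤ)) ≠ 0 := by exact_mod_cast (Fact.out : p.Prime).ne_zero
  have h : (C (p : ℤ) * carry p).IsHomogeneous p := by
    rw [show (C (p : ℤ) : MvPolynomial (Fin 2) ℤ) = p by simp, natCast_mul_carry]
    refine ((isHomogeneous_X_pow _ _).add (isHomogeneous_X_pow _ _)).sub ?_
    simpa using ((isHomogeneous_X ℤ (0 : Fin 2)).add (isHomogeneous_X ℤ (1 : Fin 2))).pow p
  intro d hd
  exact h (by rw [coeff_C_mul]; exact mul_ne_zero hp hd)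

variable {p}

/-- Otherwise cancelling one $p$ in $\binom pi\,i!\,(p-i)!=p!$ would leave $p\mid(p-1)!$. -/
theorem sq_not_dvd_choose {i : ℕ} (hip : i < p) : ¬ p ^ 2 ∣ p.choose i := by
  have hp : p.Prime := Fact.out
  rintro ⟨c, hc⟩
  have h := Nat.choose_mul_factorial_mul_factorial hip.le
  rw [hc, ← Nat.mul_factorial_pred hp.ne_zero] at h
  have h2 : p * (c * i.factorial * (p - i).factorial) = (p - 1).factorial :=
    Nat.eq_of_mul_eq_mul_left hp.pos (by rw [← h]; ring)
  have := (hp.dvd_factorial).1 (Dvd.intro _ h2)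
  have := hp.pos
  omega

/-- The coefficient is $-\binom pi/p$. -/
theorem not_dvd_coeff_carry {i j : ℕ} (hi : i ≠ 0) (hj : j ≠ 0) (hij : i + j = p) :
    ¬ (p : ℤ) ∣ coeff (Finsupp.single 0 i + Finsupp.single 1 j) (carry p) := by
  have h := congrArg (coeff (Finsupp.single 0 i + Finsupp.single 1 j)) (natCast_mul_carry p)
  rw [show (p : MvPolynomial (Fin 2) ℤ) = C (p : ℤ) by simp, coeff_C_mul, coeff_sub, coeff_add,
    coeff_add_pow, coeff_X_pow, coeff_X_pow] at h
  have h0 : ¬ (Finsupp.single 0 p = (Finsupp.single 0 i + Finsupp.single 1 j : Fin 2 →₀ ℕ)) :=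
    fun e => hj (by simpa using (DFunLike.congr_fun e 1).symm)
  have h1 : ¬ (Finsupp.single 1 p = (Finsupp.single 0 i + Finsupp.single 1 j : Fin 2 →₀ ℕ)) :=
    fun e => hi (by simpa using (DFunLike.congr_fun e 0).symm)
  rw [if_neg h0, if_neg h1, if_pos (by simpa using hij)] at h
  rintro ⟨c, hc⟩
  apply sq_not_dvd_choose (p := p) (i := i) (by omega)
  rw [hc] at h
  have : ((p ^ 2 : ℕ) : ℤ) ∣ ((p.choose i : ℕ) : ℤ) := by
    refine ⟨-c, ?_⟩
    simp at h
    push_cast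
    linarith
  exact_mod_cast this

theorem coeff_smul_pow_char_pow {σ R : Type*} [CommRing R] [CharP R p] (f : MvPolynomial σ R)
    (d : σ →₀ ℕ) (m : ℕ) : coeff (p ^ m • d) (f ^ p ^ m) = coeff d f ^ p ^ m := by
  induction m with
  | zero => simp
  | succ m ih =>
    rw [pow_succ, pow_mul, ← map_frobenius_expand p, coeff_map, mul_comm, mul_smul,
      coeff_expand_smul _ (Fact.out : p.Prime).ne_zero, ih, frobenius_def, pow_right_comm,
      ← pow_mul]

end Carry

/-! ### Arithmetic of length-two Witt vectors and relations in $H$ -/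

section Witt

variable {p : ℕ} [Fact p.Prime] {k : Type*} [Field k]

theorem witt_eq_truncate (a b : k) :
    witt p a b = WittVector.truncate 2
      (WittVector.teichmuller p a + WittVector.verschiebung (WittVector.teichmuller p b)) := by
  ext i
  rw [WittVector.coeff_truncate, WittVector.coeff_add_of_disjoint]
  · fin_cases i <;>
      simp [witt, WittVector.teichmuller_coeff_zero, WittVector.teichmuller_coeff_pos,
        WittVector.verschiebung_coeff_zero]
  · rintro (_ | n)
    · exact Or.inr (WittVector.verschiebung_coeff_zero _)
    · exact Or.inl (WittVector.teichmuller_coeff_pos p a _ n.succ_pos)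

theorem witt_zero_left_add (a b : k) : witt p 0 a + witt p 0 b = witt p 0 (a + b) := by
  simp only [witt_eq_truncate, zero_add, WittVector.teichmuller_zero]
  rw [← map_add, ← map_add]
  ext i
  simp only [WittVector.coeff_truncate]
  fin_cases i
  · exact (WittVector.verschiebung_coeff_zero _).trans (WittVector.verschiebung_coeff_zero _).symm
  · change (WittVector.verschiebung _).coeff (0 + 1) = (WittVector.verschiebung _).coeff (0 + 1)
    simp only [WittVector.verschiebung_coeff_add_one, WittVector.add_coeff_zero,
      WittVector.teichmuller_coeff_zero]

theorem witt_add_carry (a b : k) :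
    witt p a 0 + witt p b 0 = witt p (a + b) 0 + witt p 0 (aeval ![a, b] (carry p)) := by
  have h : ∀ a b : k, witt p a 0 + witt p 0 b = witt p a b := fun a b => by
    simp only [witt_eq_truncate, WittVector.teichmuller_zero, map_zero, add_zero, zero_add, map_add]
  rw [h]
  simp only [witt_eq_truncate a, witt_eq_truncate b, WittVector.teichmuller_zero, map_zero, add_zero]
  rw [← map_add]
  ext i
  rw [WittVector.coeff_truncate]
  fin_cases i
  · simp [witt, WittVector.add_coeff_zero, WittVector.teichmuller_coeff_zero]
  · simp only [witt, carry, WittVector.add_coeff, WittVector.peval, TruncatedWittVector.coeff_mk]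
    rw [← AlgHom.comp_apply, comp_aeval]
    change _ = aeval _ _
    congr 2
    ext ⟨i, n⟩
    rcases n with _ | n <;> fin_cases i <;>
      simp [WittVector.teichmuller_coeff_zero, WittVector.teichmuller_coeff_pos]

/-- From $x\cdot Vy=V(Fx\cdot y)$; the Frobenius is what gives the second coordinate $p$ times the
weight of the first. -/
theorem witt_mul_witt [CharP k p] (t a b : k) :
    witt p t 0 * witt p a b = witt p (t * a) (t ^ p * b) := by
  have hF : WittVector.frobenius (WittVector.teichmuller p t) = WittVector.teichmuller p (t ^ p) := by
    rw [WittVector.frobenius_eq_map_frobenius, WittVector.map_teichmuller, frobenius_def]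
  simp only [witt_eq_truncate, WittVector.teichmuller_zero, map_zero, add_zero]
  rw [← map_mul, mul_add, map_mul, mul_comm _ (WittVector.verschiebung _),
    ← WittVector.verschiebung_mul_frobenius, hF, mul_comm (t ^ p) b,
    map_mul (WittVector.teichmuller p) b]

theorem X2H_add (v w : W2 p k) : X2H p k (v + w) = X2H p k v * X2H p k w :=
  Subtype.ext (by simp [X2H, ofAdd_add])

theorem phiH_mul (s t : kˣ) : phiH p k (s * t) = phiH p k s * phiH p k t :=
  Subtype.ext (by simp [phiH])

theorem phiH_mul_X2H (t : kˣ) (w : W2 p k) :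
    phiH p k t * X2H p k w = X2H p k (teich p k (t : k) ^ 2 * w) * phiH p k t := by
  have h : teich p k (t : k) * teich p k ((t⁻¹ : kˣ) : k) = 1 := by
    rw [← map_mul, Units.mul_inv, map_one]
  have key : diag p k t * upper p k w =
      upper p k (teich p k (t : k) ^ 2 * w) * diag p k t := by
    apply Subtype.ext
    rw [Matrix.SpecialLinearGroup.coe_mul, Matrix.SpecialLinearGroup.coe_mul, coe_diag, coe_upper,
      coe_upper, Matrix.mul_fin_two, Matrix.mul_fin_two]
    have h' : teich p k (t : k) * w =
        teich p k (t : k) ^ 2 * w * teich p k ((t⁻¹ : kˣ) : k) := by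
      linear_combination (-teich p k (t : k) * w) * h
    simp [h']
  exact Subtype.ext key

theorem phiH_mul_X2H_witt [CharP k p] (t : kˣ) (a b : k) :
    phiH p k t * X2H p k (witt p a b) =
      X2H p k (witt p ((t : k) ^ 2 * a) ((t : k) ^ (2 * p) * b)) * phiH p k t := by
  rw [phiH_mul_X2H, ← map_pow, teich_eq, witt_mul_witt, pow_mul]

end Witt

/-! ### Comparing coefficients of vector-valued functions -/

section Independence

variable {k : Type*} [Field k] {V : Type*} [AddCommGroup V] [Module k V]

theorem eq_of_sum_smul_eq {ι α : Type*} {χ : ι → α → k} (hχ : LinearIndependent k χ)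
    {F G : ι →₀ V}
    (h : ∀ x, (F.sum fun i w => χ i x • w) = G.sum fun i w => χ i x • w) : F = G := by
  have key : ∀ (E : ι →₀ V) (l : Module.Dual k V) (x : α),
      Finsupp.linearCombination k χ (E.mapRange l (map_zero l)) x =
        l (E.sum fun i w => χ i x • w) := fun E l x => by
    rw [Finsupp.linearCombination_apply, Finsupp.sum_mapRange_index (by simp), Finsupp.sum,
      Finsupp.sum, map_sum, Finset.sum_apply]
    simp [mul_comm]
  ext i
  rw [← sub_eq_zero, ← Module.forall_dual_apply_eq_zero_iff k]
  intro l
  have := hχ (a₁ := F.mapRange l (map_zero l)) (a₂ := G.mapRange l (map_zero l)) (by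
    ext x
    rw [key, key, h])
  simpa [sub_eq_zero] using DFunLike.congr_fun this i

theorem eq_of_forall_pow_eq [Infinite k] {m n : ℕ} (h : ∀ a : k, a ^ m = a ^ n) : m = n := by
  have : (Polynomial.X ^ m : Polynomial k) = Polynomial.X ^ n :=
    Polynomial.funext fun a => by simpa using h a
  simpa using congrArg Polynomial.natDegree this

theorem linearIndependent_pow [Infinite k] :
    LinearIndependent k (fun (n : ℕ) (a : k) => a ^ n) :=
  (linearIndependent_monoidHom k k).comp (fun n : ℕ => powMonoidHom n) fun _ _ h =>
    eq_of_forall_pow_eq fun a => DFunLike.congr_fun h a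

theorem linearIndependent_zpow [Infinite k] :
    LinearIndependent k (fun (n : ℤ) (t : kˣ) => ((t ^ n : kˣ) : k)) := by
  refine (linearIndependent_monoidHom kˣ k).comp
    (fun n : ℤ => (Units.coeHom k).comp (zpowGroupHom n)) fun m n h => ?_
  -- Shift both exponents to be positive, so that the identity on $k^\times$ extends to $0$.
  obtain ⟨c, d, hc, hd, hcd⟩ : ∃ c d : ℕ, c ≠ 0 ∧ d ≠ 0 ∧ (c : ℤ) - d = m - n :=
    ⟨(m + (m.natAbs + n.natAbs + 1)).toNat, (n + (m.natAbs + n.natAbs + 1)).toNat,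
      by omega, by omega, by omega⟩
  have : c = d := by
    refine eq_of_forall_pow_eq (k := k) fun a => ?_
    by_cases ha : a = 0
    · simp [ha, hc, hd]
    · have h1 : (Units.mk0 a ha) ^ m = (Units.mk0 a ha) ^ n := Units.ext (DFunLike.congr_fun h _)
      have h2 : (Units.mk0 a ha) ^ c = (Units.mk0 a ha) ^ d := by
        rw [← zpow_natCast, ← zpow_natCast, show (c : ℤ) = m - n + d by omega, zpow_add, zpow_sub,
          h1, mul_inv_cancel, one_mul]
      simpa using congrArg Units.val h2
  omega

theorem sum_coeff_smul_eq [Infinite k] {σ ι κ : Type*} {s : Finset ι} {t : Finset κ}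
    {P : ι → MvPolynomial σ k} {Q : κ → MvPolynomial σ k} {u : ι → V} {w : κ → V}
    (h : ∀ x, ∑ i ∈ s, eval x (P i) • u i = ∑ j ∈ t, eval x (Q j) • w j) (d : σ →₀ ℕ) :
    ∑ i ∈ s, coeff d (P i) • u i = ∑ j ∈ t, coeff d (Q j) • w j := by
  rw [← sub_eq_zero, ← Module.forall_dual_apply_eq_zero_iff k]
  intro l
  have : ∑ i ∈ s, C (l (u i)) * P i = ∑ j ∈ t, C (l (w j)) * Q j :=
    MvPolynomial.funext fun x => by
      simpa [mul_comm] using congrArg l (h x)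
  have hd := congrArg (coeff d) this
  simp only [coeff_sum, coeff_C_mul] at hd
  simpa [sub_eq_zero, mul_comm] using hd

/-- If the coefficient of `b ^ j` in `R b v` vanishes, so does that of `a ^ i * b ^ j` in
`R a (R b v)`. -/
theorem sum_coeff_smul_eq_zero [Infinite k] {R : k → V →ₗ[k] V} {A : V → ℕ →₀ V}
    (hA : ∀ v a, R a v = (A v).sum fun i w => a ^ i • w) {v : V} {κ : Type*} {t : Finset κ}
    {Q : κ → MvPolynomial (Fin 2) k} {w : κ → V}
    (h : ∀ a b, R a (R b v) = ∑ x ∈ t, eval ![a, b] (Q x) • w x) {j : ℕ} (hj : A v j = 0)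
    (i : ℕ) :
    ∑ x ∈ t, coeff (Finsupp.single 0 i + Finsupp.single 1 j) (Q x) • w x = 0 := by
  have key := sum_coeff_smul_eq
    (s := (A v).support.sigma fun j => (A (A v j)).support) (t := t)
    (P := fun x => (monomial (Finsupp.single 0 x.2 + Finsupp.single 1 x.1 : Fin 2 →₀ ℕ) (1 : k)))
    (u := fun x => A (A v x.1) x.2) (Q := Q) (w := w) (fun x => by
      have hx : x = ![x 0, x 1] := by ext i; fin_cases i <;> rfl
      rw [hx, ← h, hA v, Finsupp.sum, map_sum, Finset.sum_sigma]
      refine Finset.sum_congr rfl fun j _ => ?_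
      rw [map_smul, hA, Finsupp.sum, Finset.smul_sum]
      refine Finset.sum_congr rfl fun i _ => ?_
      rw [smul_smul, monomial_fin_two]
      simp [mul_comm]) (Finsupp.single 0 i + Finsupp.single 1 j)
  rw [← key]
  refine Finset.sum_eq_zero fun x hx => ?_
  rw [coeff_monomial, if_neg, zero_smul]
  intro e
  have e1 : x.1 = j := by simpa using DFunLike.congr_fun e 1
  exact (Finsupp.mem_support_iff.1 (Finset.mem_sigma.1 hx).1) (e1 ▸ hj)

end Independence

/-! ### Restricting rational representations to one-parameter families -/

section Rational

variable {p : ℕ} [Fact p.Prime] {k : Type*} [Field k] {V : Type*} [AddCommGroup V] [Module k V]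

/-- Regular functions are polynomials in the coordinates, so their pullbacks along `γ` stay in the
span of the `χ i`. The monoid `ι` is $\mathbf N$ for unipotent families and $\mathbf Z$ for the
torus. -/
theorem IsRational.exists_coeff {ρ : Representation k (H p k) V} (hρ : IsRational ρ)
    {ι α : Type*} [AddCommMonoid ι] (χ : Multiplicative ι →* (α → k)) (γ : α → H p k)
    (hγ : ∀ c : Fin 2 × Fin 2 × Fin 2,
      (fun x => TruncatedWittVector.coeff c.2.2 ((γ x : Gamma2 p k) c.1 c.2.1)) ∈
        (AddMonoidAlgebra.lift k (α → k) ι χ).range) (v : V) :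
    ∃ F : ι →₀ V, ∀ x, ρ (γ x) v = F.sum fun i w => χ (.ofAdd i) x • w := by
  obtain ⟨n, w, f, hf⟩ := hρ v
  have hle : regularFunctions p k ≤ (AddMonoidAlgebra.lift k (α → k) ι χ).range.comap
      (AlgHom.pi fun x => Pi.evalAlgHom k (fun _ : H p k => k) (γ x)) := by
    rw [regularFunctions, ← Algebra.adjoin_range_eq_range_aeval]
    refine Algebra.adjoin_le ?_
    rintro _ ⟨c, rfl⟩
    exact hγ c
  choose g hg using fun i => hle (f i).2
  refine ⟨∑ i, Finsupp.mapRange.linearMap (LinearMap.toSpanSingleton k V (w i)) (g i).coeff,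
    fun x => ?_⟩
  have hsum : ∀ F : ι →₀ V, (F.sum fun i w => χ (.ofAdd i) x • w) =
      Finsupp.lsum k (fun i => χ (.ofAdd i) x • (LinearMap.id : V →ₗ[k] V)) F := fun F => by
    rw [Finsupp.lsum_apply]
    rfl
  rw [hf, hsum, map_sum]
  refine Finset.sum_congr rfl fun i _ => ?_
  have hi : (f i : H p k → k) (γ x) = _ := (congrFun (hg i) x).symm
  rw [hi, ← hsum]
  simp only [AlgHom.toRingHom_eq_coe, RingHom.coe_coe, Finsupp.mapRange.linearMap_apply]
  rw [Finsupp.sum_mapRange_index (by simp), AddMonoidAlgebra.lift_apply, Finsupp.sum, Finsupp.sum,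
    Finset.sum_apply, Finset.sum_smul]
  refine Finset.sum_congr rfl fun j _ => ?_
  simp [smul_smul, mul_comm]

end Rational

variable {p : ℕ} [Fact p.Prime] {k : Type*} [Field k] {V : Type*} [AddCommGroup V] [Module k V]

theorem coeff_one (i : Fin 2) : (1 : W2 p k).coeff i = if i = 0 then 1 else 0 := by
  rw [← map_one (teich p k), teich_eq]
  fin_cases i <;> simp [witt]

theorem coeff_X2H_witt (a b : k) (c : Fin 2 × Fin 2 × Fin 2) :
    TruncatedWittVector.coeff c.2.2 ((X2H p k (witt p a b) : Gamma2 p k) c.1 c.2.1) =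
      if c.1 = 0 ∧ c.2.1 = 1 then ![a, b] c.2.2
      else if c.1 = c.2.1 ∧ c.2.2 = 0 then 1 else 0 := by
  obtain ⟨i, j, l⟩ := c
  change TruncatedWittVector.coeff l
    ((!![1, witt p a b; 0, 1] : Matrix (Fin 2) (Fin 2) (W2 p k)) i j) = _
  fin_cases i <;> fin_cases j <;> simp [coeff_one, witt]

theorem coeff_phiH (t : kˣ) (c : Fin 2 × Fin 2 × Fin 2) :
    TruncatedWittVector.coeff c.2.2 ((phiH p k t : Gamma2 p k) c.1 c.2.1) =
      if c.1 = c.2.1 ∧ c.2.2 = 0 then (if c.1 = 0 then (t : k) else ((t⁻¹ : kˣ) : k)) else 0 := by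
  obtain ⟨i, j, l⟩ := c
  change TruncatedWittVector.coeff l ((!![teich p k (t : k), 0; 0, teich p k ((t⁻¹ : kˣ) : k)] :
    Matrix (Fin 2) (Fin 2) (W2 p k)) i j) = _
  fin_cases i <;> fin_cases j <;> fin_cases l <;> simp [teich_eq, witt]

theorem X2H_witt_zero : X2H p k (witt p 0 0) = 1 := by
  have h : witt p (0 : k) 0 = 0 := by
    ext i
    fin_cases i <;> simp [witt]
  exact Subtype.ext (by simp [X2H, h])

variable {ρ : Representation k (H p k) V}

theorem IsRational.exists_coeff_X2H (hρ : IsRational ρ) (α β : k) :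
    ∃ A : V → ℕ →₀ V, ∀ v a,
      ρ (X2H p k (witt p (α * a) (β * a))) v = (A v).sum fun i w => a ^ i • w := by
  have key := hρ.exists_coeff (powersHom (k → k) id)
    (fun a => X2H p k (witt p (α * a) (β * a))) (fun c => by
      simp only [coeff_X2H_witt]
      set S := (AddMonoidAlgebra.lift k (k → k) ℕ (powersHom (k → k) id)).range
      have hid : (id : k → k) ∈ S := ⟨AddMonoidAlgebra.single 1 1, by simp⟩
      split_ifs
      · obtain ⟨i, j, l⟩ := c
        fin_cases l
        · exact S.smul_mem hid α
        · exact S.smul_mem hid β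
      · exact S.one_mem
      · exact S.zero_mem)
  choose A hA using key
  exact ⟨A, fun v a => by simpa using hA v a⟩

theorem IsRational.exists_coeff_phiH (hρ : IsRational ρ) (v : V) :
    ∃ F : ℤ →₀ V, ∀ t : kˣ, ρ (phiH p k t) v = F.sum fun i w => ((t ^ i : kˣ) : k) • w := by
  let χ : Multiplicative ℤ →* (kˣ → k) :=
    { toFun n t := ((t ^ n.toAdd : kˣ) : k)
      map_one' := by ext; simp
      map_mul' m n := by ext; simp [zpow_add] }
  refine hρ.exists_coeff χ (phiH p k) (fun c => ?_) v
  simp only [coeff_phiH]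
  set S := (AddMonoidAlgebra.lift k (kˣ → k) ℤ χ).range
  split_ifs
  · exact ⟨AddMonoidAlgebra.single 1 1, (AddMonoidAlgebra.lift_single _ _ _).trans (by ext; simp [χ])⟩
  · exact ⟨AddMonoidAlgebra.single (-1) 1,
      (AddMonoidAlgebra.lift_single _ _ _).trans (by ext; simp [χ])⟩
  · exact S.zero_mem

/-! ### Weights -/

theorem IsRational.exists_sum_weightSpace [Infinite k] (hρ : IsRational ρ) (v : V) :
    ∃ F : ℤ →₀ V, (∀ μ, F μ ∈ weightSpace ρ μ) ∧ v = F.sum fun _ w => w := by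
  obtain ⟨F, hF⟩ := hρ.exists_coeff_phiH v
  refine ⟨F, fun μ s => ?_, ?_⟩
  -- Compare coefficients of $t^\mu$ in $\phi(s)\phi(t)v=\phi(st)v$.
  · have := eq_of_sum_smul_eq (k := k) linearIndependent_zpow
      (F := F.mapRange (ρ (phiH p k s)) (map_zero _))
      (G := Finsupp.onFinset F.support (fun i => ((s ^ i : kˣ) : k) • F i)
        (fun i hi => Finsupp.mem_support_iff.2 fun h => hi (by simp [h]))) (fun t => by
      have h : ρ (phiH p k s) (ρ (phiH p k t) v) = ρ (phiH p k (s * t)) v := by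
        rw [phiH_mul, map_mul]
        rfl
      rw [hF t, hF, Finsupp.sum, map_sum] at h
      rw [Finsupp.sum_mapRange_index (by simp), Finsupp.onFinset_sum _ (by simp)]
      simp only [map_smul] at h
      refine Eq.trans h (Finset.sum_congr rfl fun i _ => ?_)
      simp [smul_smul, mul_zpow, mul_comm])
    simpa using DFunLike.congr_fun this μ
  · have h1 : phiH p k 1 = 1 := Subtype.ext (map_one (phi p k))
    simpa [h1] using hF 1

/-- If `φ(t)` conjugates `R a` to `R (t ^ e * a)`, the coefficient of `a ^ i` in `R a` raises
weights by `e * i`. -/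
theorem coeff_mem_weightSpace [Infinite k] {R : k → V →ₗ[k] V} {A : V → ℕ →₀ V} {e : ℕ}
    (hA : ∀ v a, R a v = (A v).sum fun i w => a ^ i • w)
    (hR : ∀ (t : kˣ) a v, ρ (phiH p k t) (R a v) = R ((t : k) ^ e * a) (ρ (phiH p k t) v))
    {μ : ℤ} {v : V} (hv : v ∈ weightSpace ρ μ) (i : ℕ) :
    A v i ∈ weightSpace ρ (μ + e * i) := by
  intro t
  have := eq_of_sum_smul_eq (k := k) linearIndependent_pow
    (F := (A v).mapRange (ρ (phiH p k t)) (map_zero _))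
    (G := Finsupp.onFinset (A v).support (fun i => ((t ^ (μ + e * i) : kˣ) : k) • A v i)
      (fun i hi => Finsupp.mem_support_iff.2 fun h => hi (by simp [h]))) (fun a => by
    have h := hR t a v
    rw [hv t, map_smul, hA v, hA v, Finsupp.sum, map_sum, Finsupp.sum, Finset.smul_sum] at h
    rw [Finsupp.sum_mapRange_index (by simp), Finsupp.onFinset_sum _ (by simp)]
    simp only [map_smul] at h
    refine Eq.trans h (Finset.sum_congr rfl fun i _ => ?_)
    rw [smul_smul, smul_smul]
    congr 1
    have : t ^ (μ + (e : ℤ) * i) = t ^ μ * (t ^ e) ^ i := by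
      rw [zpow_add, zpow_mul, zpow_natCast, zpow_natCast]
    rw [this]
    push_cast
    ring)
  simpa using DFunLike.congr_fun this i

/-! ### Degrees forced by the group law -/

/-- The smallest positive degree occurring in a one-parameter additive group action in
characteristic `p` is a power of `p`. -/
theorem eq_pow_of_forall_coeff_eq_zero [Infinite k] [CharP k p] {R : k → V →ₗ[k] V}
    {B : V → ℕ →₀ V} (hB : ∀ v a, R a v = (B v).sum fun i w => a ^ i • w)
    (hR : ∀ a b v, R a (R b v) = R (a + b) v) {v : V} {n : ℕ} (hn : 0 < n) (hv : B v n ≠ 0)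
    (hmin : ∀ l, 0 < l → l < n → B v l = 0) : ∃ m, n = p ^ m := by
  refine ⟨_, Choose.eq_pow_multiplicity_of_choose_modEq_zero_nat hn fun i hi => ?_⟩
  rw [Finset.mem_Icc] at hi
  -- The coefficient of $a^ib^{n-i}$ is $\binom ni B_nv$ on one side and, by minimality, $0$ on the
  -- other.
  have key := sum_coeff_smul_eq_zero hB (v := v) (t := (B v).support)
    (Q := fun l => (X 0 + X 1) ^ l) (w := B v)
    (fun a b => by rw [hR, hB v, Finsupp.sum]; simp) (hmin (n - i) (by omega) (by omega)) i
  rw [Finset.sum_eq_single n] at key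
  · rw [coeff_add_pow, if_pos (by simp; omega), smul_eq_zero, or_iff_left hv] at key
    rw [Nat.modEq_zero_iff_dvd, ← CharP.cast_eq_zero_iff k p]
    simpa using key
  · intro l _ hl
    rw [coeff_add_pow, if_neg (by simp; omega), Nat.cast_zero, zero_smul]
  · intro h
    exact absurd (Finsupp.mem_support_iff.2 hv) h

/-- Let `R a` and `S b` be the operators of `(a, 0)` and `(0, b)` in an action of the Witt vectors
of length two, with coefficients `A` and `B`, and let `p ^ m` be the smallest positive degree
occurring in `S b v`. Then all the degrees `p ^ m * j` with `0 < j < p` occur in `R a v`. -/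
theorem coeff_ne_zero_of_carry [Infinite k] [CharP k p] {R S : k → V →ₗ[k] V} {A B : V → ℕ →₀ V}
    (hA : ∀ v a, R a v = (A v).sum fun i w => a ^ i • w)
    (hB : ∀ v a, S a v = (B v).sum fun i w => a ^ i • w) (hR0 : ∀ v, R 0 v = v)
    (hRS : ∀ a b v, R a (R b v) = R (a + b) (S (aeval ![a, b] (carry p)) v)) {v : V} {m : ℕ}
    (hv : B v (p ^ m) ≠ 0) (hmin : ∀ l, 0 < l → l < p ^ m → B v l = 0) {i j : ℕ} (hi : i ≠ 0)
    (hj : j ≠ 0) (hij : i + j = p) : A v (p ^ m * j) ≠ 0 := by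
  intro h0
  have hp : p.Prime := Fact.out
  have hA0 : ∀ u, A u 0 = u := fun u => by
    have h := hA u 0
    rw [hR0, Finsupp.sum, Finset.sum_eq_single 0 (fun b _ hb => by simp [hb]) (by simp)] at h
    simpa using h.symm
  have hsum : p ^ m * i + p ^ m * j = p ^ (m + 1) := by rw [← mul_add, hij, pow_succ]
  have key := sum_coeff_smul_eq_zero hA (v := v)
    (t := (B v).support.sigma fun l => (A (B v l)).support)
    (Q := fun x => (X 0 + X 1) ^ x.2 * map (Int.castRingHom k) (carry p) ^ x.1)
    (w := fun x => A (B v x.1) x.2)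
    (fun a b => by
      rw [hRS, hB, Finsupp.sum, map_sum, Finset.sum_sigma]
      refine Finset.sum_congr rfl fun l _ => ?_
      rw [map_smul, hA, Finsupp.sum, Finset.smul_sum]
      refine Finset.sum_congr rfl fun n _ => ?_
      rw [smul_smul, map_mul, map_pow, map_pow, eval_map, aeval_def, mul_comm]
      simp) h0 (p ^ m * i)
  -- The term $(a+b)^n c^l$ has degree $n+pl$, which must be $p^{m+1}$. If $l=0$, its coefficient is
  -- a binomial divisible by $p$; otherwise $l\ge p^m$, so $l=p^m$ and $n=0$.
  rw [Finset.sum_eq_single ⟨p ^ m, 0⟩] at key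
  · have hd : (Finsupp.single 0 (p ^ m * i) + Finsupp.single 1 (p ^ m * j) : Fin 2 →₀ ℕ) =
        p ^ m • (Finsupp.single 0 i + Finsupp.single 1 j) := by
      simp [smul_add]
    rw [hA0, smul_eq_zero, or_iff_left hv, pow_zero, one_mul, hd, coeff_smul_pow_char_pow,
      coeff_map] at key
    exact not_dvd_coeff_carry hi hj hij
      ((CharP.intCast_eq_zero_iff k p _).1 (eq_zero_of_pow_eq_zero key))
  · rintro ⟨l, n⟩ hx hne
    have hl : B v l ≠ 0 := Finsupp.mem_support_iff.1 (Finset.mem_sigma.1 hx).1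
    have hhom : ((X 0 + X 1) ^ n * map (Int.castRingHom k) (carry p) ^ l).IsHomogeneous
        (1 * n + p * l) :=
      (((isHomogeneous_X k (0 : Fin 2)).add (isHomogeneous_X k (1 : Fin 2))).pow n).mul
        (((carry_isHomogeneous p).map _).pow l)
    by_cases hdeg : p ^ (m + 1) = 1 * n + p * l
    · rcases Nat.eq_zero_or_pos l with rfl | hpos
      · have hn : n = p ^ (m + 1) := by omega
        have hpm : p ^ m ≠ 0 := pow_ne_zero _ hp.ne_zero
        have hi0 : p ^ m * i ≠ 0 := mul_ne_zero hpm hi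
        have hj0 : p ^ m * j ≠ 0 := mul_ne_zero hpm hj
        have hdvd : p ∣ (p ^ (m + 1)).choose (p ^ m * i) :=
          hp.dvd_choose_pow hi0 (by omega)
        simp only [pow_zero, mul_one, coeff_add_pow]
        rw [if_pos (by simp; omega), hn]
        simp [(CharP.cast_eq_zero_iff k p _).2 hdvd]
      · have hle : p ^ m ≤ l := not_lt.1 fun h => hl (hmin l hpos h)
        have h1 : p ^ (m + 1) = p * p ^ m := pow_succ' p m
        have h2 : p * p ^ m ≤ p * l := Nat.mul_le_mul_left p hle
        have hn : n = 0 := by omega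
        have hlm : l = p ^ m := Nat.eq_of_mul_eq_mul_left hp.pos (by omega)
        subst hn hlm
        exact absurd rfl hne
    · dsimp only
      rw [hhom.coeff_eq_zero, zero_smul]
      rw [map_add, Finsupp.degree_single, Finsupp.degree_single, hsum]
      exact hdeg
  · intro h
    refine absurd (Finset.mem_sigma.2 ⟨Finsupp.mem_support_iff.2 hv, ?_⟩) h
    exact Finsupp.mem_support_iff.2 (by rw [hA0]; exact hv)

theorem exists_forall_weightSpace_ne_bot [Infinite k] [CharP k p] {ρ : Representation k (H p k) V}
    (hρ : IsRational ρ) (hne : ρ (X2H p k (witt p 0 1)) ≠ 1) :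
    ∃ s : ℤ, 0 < s ∧ ∃ l : ℤ, ∀ j : ℕ, j ≤ p → weightSpace ρ (l + 2 * s * (j : ℤ)) ≠ ⊥ := by
  classical
  have hp : p.Prime := Fact.out
  obtain ⟨A, hA⟩ := hρ.exists_coeff_X2H 1 0
  obtain ⟨B, hB⟩ := hρ.exists_coeff_X2H 0 1
  simp only [one_mul, zero_mul] at hA hB
  have hX0 : ∀ v, ρ (X2H p k (witt p 0 0)) v = v := fun v => by simp [X2H_witt_zero]
  have hAw : ∀ {μ : ℤ} {v : V}, v ∈ weightSpace ρ μ →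
      ∀ i : ℕ, A v i ∈ weightSpace ρ (μ + (2 : ℕ) * i) :=
    fun hv => coeff_mem_weightSpace (R := fun a => ρ (X2H p k (witt p a 0))) hA
      (fun t a v => by
        rw [← Module.End.mul_apply, ← map_mul, phiH_mul_X2H_witt, mul_zero, map_mul,
          Module.End.mul_apply]) hv
  have hBw : ∀ {μ : ℤ} {v : V}, v ∈ weightSpace ρ μ →
      ∀ i : ℕ, B v i ∈ weightSpace ρ (μ + (2 * p : ℕ) * i) :=
    fun hv => coeff_mem_weightSpace (R := fun a => ρ (X2H p k (witt p 0 a))) hB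
      (fun t a v => by
        rw [← Module.End.mul_apply, ← map_mul, phiH_mul_X2H_witt, mul_zero, map_mul,
          Module.End.mul_apply]) hv
  have hex : ∃ n, 0 < n ∧ ∃ μ, ∃ v ∈ weightSpace ρ μ, B v n ≠ 0 := by
    -- Otherwise each $S_b$ is constant in $b$ on weight vectors, hence equal to $S_0=1$ there, and
    -- these span $V$.
    by_contra! hcon
    refine hne (LinearMap.ext fun v => ?_)
    obtain ⟨F, hF, rfl⟩ := hρ.exists_sum_weightSpace v
    rw [Finsupp.sum, map_sum]
    refine Finset.sum_congr rfl fun μ _ => ?_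
    have hconst : ∀ b : k, ρ (X2H p k (witt p 0 b)) (F μ) = B (F μ) 0 := fun b => by
      rw [hB, Finsupp.sum_eq_single 0
        (fun i _ hi => by rw [hcon i (Nat.pos_of_ne_zero hi) μ _ (hF μ), smul_zero]) (by simp)]
      simp
    rw [hconst, ← hconst 0, hX0]
  obtain ⟨hn, μ, v, hv, hBv⟩ := Nat.find_spec hex
  have hmin : ∀ l, 0 < l → l < Nat.find hex → B v l = 0 := fun l hl hlt => by
    by_contra h
    exact Nat.find_min hex hlt ⟨hl, μ, v, hv, h⟩
  obtain ⟨m, hm⟩ := eq_pow_of_forall_coeff_eq_zero (p := p)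
    (R := fun a => ρ (X2H p k (witt p 0 a))) hB
    (fun a b v => by
      rw [← Module.End.mul_apply, ← map_mul, ← X2H_add, witt_zero_left_add]) hn hBv hmin
  rw [hm] at hBv hmin
  have hv0 : v ≠ 0 := by
    rintro rfl
    refine hBv ?_
    have h0 : B 0 = 0 := eq_of_sum_smul_eq (k := k) linearIndependent_pow fun a => by
      rw [← hB, map_zero, Finsupp.sum_zero_index]
    rw [h0, Finsupp.zero_apply]
  refine ⟨p ^ m, by exact_mod_cast pow_pos hp.pos m, μ, fun j hj => ?_⟩
  rcases Nat.eq_zero_or_pos j with rfl | hj0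
  · exact (Submodule.ne_bot_iff _).2 ⟨v, by simpa using hv, hv0⟩
  rcases hj.eq_or_lt with rfl | hjp
  -- Here `j` has replaced `p`; the weight shift $2p\cdot p^m$ is $2sj$ with $j=p$.
  · refine (Submodule.ne_bot_iff _).2 ⟨B v (j ^ m), ?_, hBv⟩
    convert hBw hv (j ^ m) using 2
    push_cast
    ring
  · refine (Submodule.ne_bot_iff _).2 ⟨A v (p ^ m * j), ?_, ?_⟩
    · convert hAw hv (p ^ m * j) using 2
      push_cast
      ring
    · exact coeff_ne_zero_of_carry (R := fun a => ρ (X2H p k (witt p a 0)))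
        (S := fun a => ρ (X2H p k (witt p 0 a))) hA hB hX0
        (fun a b v => by
          simp only [← Module.End.mul_apply, ← map_mul, ← X2H_add, witt_add_carry])
        hBv hmin (i := p - j) (by omega) hj0.ne' (by omega)

end WittSL2

theorem mainTheorem7 (p : ℕ) [Fact p.Prime] (k : Type*) [Field k] [IsAlgClosed k] [CharP k p]
    (V : Type*) [AddCommGroup V] [Module k V]
    (ρ : Representation k (WittSL2.H p k) V) (hρ : WittSL2.IsRational ρ)
    (hne : ρ (WittSL2.X2H p k (WittSL2.witt p 0 1)) ≠ 1) :
    (∃ s : ℤ, 0 < s ∧ ∃ l : ℤ, ∀ j : ℕ, j ≤ p →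
      WittSL2.weightSpace ρ (l + 2 * s * (j : ℤ)) ≠ ⊥) ∧
    ((p + 1 : ℕ) : ℕ∞) ≤ Set.encard {μ : ℤ | WittSL2.weightSpace ρ μ ≠ ⊥} := by
  have : Infinite k := IsAlgClosed.instInfinite
  have h := WittSL2.exists_forall_weightSpace_ne_bot hρ hne
  refine ⟨h, ?_⟩
  obtain ⟨s, hs, l, hl⟩ := h
  have hinj : Function.Injective fun j : ℕ => l + 2 * s * (j : ℤ) := fun i j hij => by
    simpa [hs.ne'] using hij
  have hsub : ((Finset.range (p + 1)).image fun j : ℕ => l + 2 * s * (j : ℤ) : Set ℤ) ⊆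
      {μ : ℤ | WittSL2.weightSpace ρ μ ≠ ⊥} := by
    intro μ hμ
    obtain ⟨j, hj, rfl⟩ := Finset.mem_image.1 (Finset.mem_coe.1 hμ)
    exact hl j (Nat.lt_succ_iff.1 (Finset.mem_range.1 hj))
  refine le_trans (le_of_eq ?_) (Set.encard_le_encard hsub)
  rw [Set.encard_coe_eq_coe_finsetCard, Finset.card_image_of_injective _ hinj, Finset.card_range]
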